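/- Let $n,m\ge 0$ be integers, $\epsilon\in(0,1)$, $\delta>0$, let $a:\mathbb R^n\to\mathbb R^m$ and $b:\mathbb R^n\to\mathbb R$ be affine, let $\mu\in\mathbb R^m$ and let $\Sigma\in\mathbb R^{m\times m}$ be symmetric positive definite. Let $\mathbb P=N(\mu,\Sigma)$ and let $\mathcal P$ be the set of all probability distributions $\mathbb Q$ on $\mathbb R^m$ with $d_W(\mathbb Q,\mathbb P)\le\delta$, where $$d_W(\mathbb P_1,\mathbb P_2)=\inf\big\{\mathbb E_{\mathbb P_0}\|\Sigma^{-1/2}(X_1-X_2)\|_2:\ \mathbb P_0\text{ a joint distribution of }(X_1,X_2)\text{ with marginals }\mathbb P_1,\mathbb P_2\big\}\in[0,\infty].$$ Let $$\mathcal X=\Big\{x\in\mathbb R^n:\ \sup_{\mathbb Q\in\mathcal P}\mathbb Q\big[a(x)^\top\xi\le b(x)\big]\ge 1-\epsilon\Big\}$$ be the feasible region of the individual optimistic chance constraint, where $\xi$ has distribution $\mathbb Q$. For a real random variable $Z$ and $p\in(0,1)$ write $\mathrm{CVaR}_p(Z)=\min_{\gamma\in\mathbb R}\{\gamma+\frac1{1-p}\mathbb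 E[(Z-\gamma)^+]\}$, let $Y$ be a standard one-dimensional Gaussian random variable, and put $$c_o=\sup_{\epsilon'\in(\epsilon,1)}\frac{-\delta+(1-\epsilon')\,\mathrm{CVaR}_{\epsilon'}(Y)-(1-\epsilon)\,\mathrm{CVaR}_{\epsilon}(Y)}{\epsilon'-\epsilon}.$$ Then $c_o$ is finite and $$\mathcal X=\big\{x\in\mathbb R^n:\ a(x)^\top\mu+c_o\,\|\Sigma^{1/2}a(x)\|_2\le b(x)\big\}.$$ Moreover, if $c_o\ge 0$, then $\mathcal X$ is convex and is a second-order cone set, i.e. $\mathcal X=\{x:\|F(x)\|_2\le g(x)\}$ for some affine maps $F:\mathbb R^n\to\mathbb R^k$ and $g:\mathbb R^n\to\mathbb R$. -/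

import Mathlib

open MeasureTheory ProbabilityTheory
open scoped ENNReal MatrixOrder

noncomputable section

namespace OptimisticCC

/-- Conditional value-at-risk of a real random variable with law `ν` at level `p ∈ (0,1)`:
`CVaR_p = min_γ { γ + (1 - p)⁻¹ E[(X - γ)⁺] }`. -/
def cvar (p : ℝ) (ν : Measure ℝ) : ℝ :=
  ⨅ γ : ℝ, (γ + 1 / (1 - p) * ∫ y, max (y - γ) 0 ∂ν)

section Wasserstein

variable {E : Type*} [MeasurableSpace E]

/-- The couplings of `P₁` and `P₂`: joint distributions with marginals `P₁` and `P₂`. -/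
def couplings (P₁ P₂ : Measure E) : Set (Measure (E × E)) :=
  {π | π.map Prod.fst = P₁ ∧ π.map Prod.snd = P₂}

/-- The (type-1) Wasserstein distance, possibly infinite, with transport cost `N (x₁ - x₂)`,
where `N` is a norm on `E`. -/
def wassersteinDist [Sub E] (N : E → ℝ) (P₁ P₂ : Measure E) : ℝ≥0∞ :=
  ⨅ π ∈ couplings P₁ P₂, ∫⁻ z, ENNReal.ofReal (N (z.1 - z.2)) ∂π

/-- The Wasserstein ball of radius `δ` around the reference distribution `P`. -/
def wassersteinBall [Sub E] (N : E → ℝ) (P : Measure E) (δ : ℝ) : Set (Measure E) :=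
  {Q | IsProbabilityMeasure Q ∧ wassersteinDist N Q P ≤ ENNReal.ofReal δ}

end Wasserstein

variable {n m : ℕ}

/-- `Σ^{1/2} v`, with the positive semidefinite square root of `S`. -/
def sqrtMul (S : Matrix (Fin m) (Fin m) ℝ) (v : EuclideanSpace ℝ (Fin m)) :
    EuclideanSpace ℝ (Fin m) :=
  Matrix.toEuclideanCLM (𝕜 := ℝ) (CFC.sqrt S) v

/-- `Σ^{-1/2} v`. -/
def invSqrtMul (S : Matrix (Fin m) (Fin m) ℝ) (v : EuclideanSpace ℝ (Fin m)) :
    EuclideanSpace ℝ (Fin m) :=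
  Matrix.toEuclideanCLM (𝕜 := ℝ) (CFC.sqrt S)⁻¹ v

/-- The feasible region of the individual optimistic chance constraint
`sup_{Q ∈ A} Q[a(x)ᵀ ξ ≤ b(x)] ≥ 1 - ε` over the ambiguity set `A`. -/
def feasibleRegion (A : Set (Measure (EuclideanSpace ℝ (Fin m)))) (ε : ℝ)
    (a : EuclideanSpace ℝ (Fin n) →ᵃ[ℝ] EuclideanSpace ℝ (Fin m))
    (b : EuclideanSpace ℝ (Fin n) →ᵃ[ℝ] ℝ) : Set (EuclideanSpace ℝ (Fin n)) :=
  {x | ENNReal.ofReal (1 - ε) ≤ ⨆ Q ∈ A, Q {ξ | inner ℝ (a x) ξ ≤ b x}}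

/-- The expression whose supremum over `ε' ∈ (ε, 1)` is `c_o`; here `Y ∼ N(0,1)`. -/
def coExpr (δ ε ε' : ℝ) : ℝ :=
  (-δ + (1 - ε') * cvar ε' (gaussianReal 0 1) - (1 - ε) * cvar ε (gaussianReal 0 1)) / (ε' - ε)

/-- The constant `c_o`. -/
def co (δ ε : ℝ) : ℝ := sSup (coExpr δ ε '' Set.Ioo ε 1)

/-- Sets described by one second-order cone constraint `‖F x‖₂ ≤ g x`, `F` and `g` affine. -/
def IsSecondOrderConeSet (X : Set (EuclideanSpace ℝ (Fin n))) : Prop :=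
  ∃ (k : ℕ) (F : EuclideanSpace ℝ (Fin n) →ᵃ[ℝ] EuclideanSpace ℝ (Fin k))
    (g : EuclideanSpace ℝ (Fin n) →ᵃ[ℝ] ℝ), X = {x | ‖F x‖ ≤ g x}

end OptimisticCC

end

open Filter Topology

noncomputable section

namespace OptimisticCC

/-! For `a(x) ≠ 0`, put `t = (b(x) - a(x)ᵀμ) / ‖Σ^{1/2} a(x)‖`. The standardized functional has law
`N(0,1)`, is 1-Lipschitz for the transport cost, and moves at unit speed along some direction of
unit cost. Feasibility thus becomes one-dimensional: can `Y` be moved at cost at most `δ` so that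
mass `1 - ε` lies below `t`? With `κ` the upper `ε`-quantile and `t < κ`, the cheapest plan leaves
the mass above `κ` and pulls `(t, κ]` down to `t`, at cost `E(Y-t)⁺ - E(Y-κ)⁺ - ε(κ-t)`; see
`meanExcess_le_of_coupling` for optimality and `exists_mem_wassersteinBall_of_co_le` for attainment.

By symmetry of `Y`, `G(p) = (1-p) CVaR_p(Y)` equals `min_γ {pγ + E(Y-γ)⁺}`. Now `c_o ≤ t` says
`G(ε') - ε't ≤ δ + G(ε) - εt` for all `ε' ∈ (ε,1)`. The left side is at most `E(Y-t)⁺`, with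
equality at `ε' = P(Y > t)`, and `G(ε) = εκ + E(Y-κ)⁺`, so this is exactly the cost bound
(`co_le_iff_meanExcess_le`). -/

/-- The mean excess `E[(X - γ)⁺]` of a real random variable `X` with law `ν` over `γ`. -/
def meanExcess (ν : Measure ℝ) (γ : ℝ) : ℝ := ∫ y, max (y - γ) 0 ∂ν

/-! ### CVaR, quantiles and partial means on the real line. -/

section Cvar

variable {ν : Measure ℝ}

lemma meanExcess_nonneg (γ : ℝ) : 0 ≤ meanExcess ν γ :=
  integral_nonneg fun _ => le_max_right _ _

variable [IsProbabilityMeasure ν]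

lemma integrable_max_sub (hν : Integrable id ν) (γ : ℝ) :
    Integrable (fun y => max (y - γ) 0) ν :=
  (hν.sub (integrable_const γ)).pos_part

lemma mean_sub_le_meanExcess (hν : Integrable id ν) (γ : ℝ) :
    ∫ y, y ∂ν - γ ≤ meanExcess ν γ := by
  have h : ∫ y, (y - γ) ∂ν = ∫ y, y ∂ν - γ := by
    rw [integral_sub (f := fun y => y) hν (integrable_const γ)]; simp
  rw [← h]
  exact integral_mono (hν.sub (integrable_const γ)) (integrable_max_sub hν γ)
    fun y => le_max_left _ _

lemma bddBelow_cvar (hν : Integrable id ν) {p : ℝ} (hp : p ∈ Set.Ioo (0 : ℝ) 1) :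
    BddBelow (Set.range fun γ : ℝ => γ + 1 / (1 - p) * ∫ y, max (y - γ) 0 ∂ν) := by
  refine ⟨∫ y, y ∂ν, ?_⟩
  rintro _ ⟨γ, rfl⟩
  have h1 := mean_sub_le_meanExcess hν γ
  have h2 : 1 ≤ 1 / (1 - p) := by
    rw [le_div_iff₀ (by linarith [hp.2])]; linarith [hp.1]
  have h3 := le_mul_of_one_le_left (meanExcess_nonneg (ν := ν) γ) h2
  change _ ≤ γ + 1 / (1 - p) * meanExcess ν γ
  linarith

lemma mul_cvar_le (hν : Integrable id ν) {p : ℝ} (hp : p ∈ Set.Ioo (0 : ℝ) 1) (γ : ℝ) :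
    (1 - p) * cvar p ν ≤ (1 - p) * γ + meanExcess ν γ := by
  have hp' : 0 < 1 - p := by linarith [hp.2]
  have h : cvar p ν ≤ γ + 1 / (1 - p) * meanExcess ν γ := ciInf_le (bddBelow_cvar hν hp) γ
  calc (1 - p) * cvar p ν ≤ (1 - p) * (γ + 1 / (1 - p) * meanExcess ν γ) := by gcongr
    _ = _ := by field_simp

/-- A quantile minimizes the convex function in the definition of the CVaR. -/
lemma meanExcess_quantile_le (hν : Integrable id ν) (κ γ : ℝ) :
    ν.real (Set.Ioi κ) * κ + meanExcess ν κ ≤ ν.real (Set.Ioi κ) * γ + meanExcess ν γ := by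
  have hi : Integrable ((Set.Ioi κ).indicator fun _ => κ - γ) ν :=
    (integrable_const _).indicator measurableSet_Ioi
  have h : ∫ y, (max (y - κ) 0 + (Set.Ioi κ).indicator (fun _ => κ - γ) y) ∂ν
      ≤ meanExcess ν γ := by
    refine integral_mono ((integrable_max_sub hν κ).add hi) (integrable_max_sub hν γ) fun y => ?_
    by_cases hy : κ < y
    · simp only [Set.indicator_of_mem (Set.mem_Ioi.2 hy), max_eq_left (sub_nonneg.2 hy.le)]
      linarith [le_max_left (y - γ) 0]
    · simp only [Set.indicator_of_notMem (show y ∉ Set.Ioi κ from hy),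
        max_eq_right (sub_nonpos.2 (not_lt.1 hy))]
      simp
  rw [integral_add (integrable_max_sub hν κ) hi, integral_indicator_const _ measurableSet_Ioi,
    smul_eq_mul] at h
  change meanExcess ν κ + _ ≤ _ at h
  linarith

lemma mul_cvar_eq_of_quantile (hν : Integrable id ν) {p κ : ℝ} (hp : p ∈ Set.Ioo (0 : ℝ) 1)
    (hκ : ν.real (Set.Ioi κ) = 1 - p) :
    (1 - p) * cvar p ν = (1 - p) * κ + meanExcess ν κ := by
  refine le_antisymm (mul_cvar_le hν hp κ) ?_
  have hp' : 0 < 1 - p := by linarith [hp.2]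
  rw [← div_le_iff₀' hp']
  refine le_ciInf fun γ => ?_
  rw [div_le_iff₀' hp']
  have h := meanExcess_quantile_le hν κ γ
  rw [hκ] at h
  calc _ ≤ (1 - p) * γ + meanExcess ν γ := h
    _ = (1 - p) * (γ + 1 / (1 - p) * meanExcess ν γ) := by field_simp

/-- The mass between `t` and `κ` contributes the partial mean `E[(X - t) 1{t < X ≤ κ}]`. -/
lemma integral_indicator_Ioc_sub (hν : Integrable id ν) {t κ : ℝ} (htκ : t ≤ κ) :
    ∫ y, (Set.Ioc t κ).indicator (fun y => y - t) y ∂ν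
      = meanExcess ν t - meanExcess ν κ - ν.real (Set.Ioi κ) * (κ - t) := by
  have hi : Integrable ((Set.Ioi κ).indicator fun _ => κ - t) ν :=
    (integrable_const _).indicator measurableSet_Ioi
  have h : (fun y => (Set.Ioc t κ).indicator (fun y => y - t) y) = fun y =>
      max (y - t) 0 - max (y - κ) 0 - (Set.Ioi κ).indicator (fun _ => κ - t) y := by
    funext y
    simp only [Set.indicator_apply, Set.mem_Ioc, Set.mem_Ioi]
    grind
  rw [h, integral_sub (f := fun y => max (y - t) 0 - max (y - κ) 0)
      ((integrable_max_sub hν t).sub (integrable_max_sub hν κ)) hi,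
    integral_sub (integrable_max_sub hν t) (integrable_max_sub hν κ),
    integral_indicator_const _ measurableSet_Ioi, smul_eq_mul]
  rfl

/-- Under a coupling of `X` with `Z ∼ ν`, the transport cost bounds the mean excess of `ν`
over `t` when `X ≤ t` holds with high probability. -/
lemma meanExcess_le_of_coupling (hν : Integrable id ν) {Ω : Type*} [MeasurableSpace Ω]
    {π : Measure Ω} [IsProbabilityMeasure π] {X Z : Ω → ℝ} (hX : Measurable X)
    (hZ : Measurable Z) (hlaw : π.map Z = ν) {c p t γ : ℝ} (hc : 0 ≤ c) (htγ : t ≤ γ)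
    (hcost : ∫⁻ ω, ENNReal.ofReal |X ω - Z ω| ∂π ≤ ENNReal.ofReal c)
    (hp : π.real {ω | t < X ω} ≤ p) :
    meanExcess ν t ≤ c + p * (γ - t) + meanExcess ν γ := by
  have hm : Measurable fun ω => |X ω - Z ω| := (hX.sub hZ).norm
  have hint : Integrable (fun ω => |X ω - Z ω|) π := by
    refine ⟨hm.aestronglyMeasurable, ?_⟩
    rw [hasFiniteIntegral_iff_ofReal (ae_of_all _ fun _ => abs_nonneg _)]
    exact hcost.trans_lt ENNReal.ofReal_lt_top
  have hcost' : ∫ ω, |X ω - Z ω| ∂π ≤ c := by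
    rw [integral_eq_lintegral_of_nonneg_ae (ae_of_all _ fun _ => abs_nonneg _)
      hm.aestronglyMeasurable]
    exact ENNReal.toReal_le_of_le_ofReal hc hcost
  have hS : MeasurableSet {ω | t < X ω} := measurableSet_lt measurable_const hX
  have hi : Integrable ({ω | t < X ω}.indicator fun _ => γ - t) π :=
    (integrable_const _).indicator hS
  have hex (s : ℝ) : Integrable (fun ω => max (Z ω - s) 0) π := by
    have := integrable_max_sub hν s
    rw [← hlaw] at this
    exact this.comp_measurable hZ
  have hexEq (s : ℝ) : ∫ ω, max (Z ω - s) 0 ∂π = meanExcess ν s := by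
    rw [meanExcess, ← hlaw, integral_map hZ.aemeasurable (by fun_prop)]
  -- Pointwise: if `X ≤ t` then `(Z-t)⁺ ≤ |X-Z|`; otherwise `(Z-t)⁺ ≤ (γ-t) + (Z-γ)⁺`.
  have hkey : ∫ ω, max (Z ω - t) 0 ∂π ≤ ∫ ω, (|X ω - Z ω|
      + {ω | t < X ω}.indicator (fun _ => γ - t) ω + max (Z ω - γ) 0) ∂π := by
    refine integral_mono (hex t) ((hint.add hi).add (hex γ)) fun ω => ?_
    simp only [Set.indicator_apply, Set.mem_ofPred_eq]
    split_ifs with h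
    · have := abs_nonneg (X ω - Z ω)
      grind
    · have := neg_abs_le (X ω - Z ω)
      have := abs_nonneg (X ω - Z ω)
      grind
  rw [integral_add (f := fun ω => |X ω - Z ω|
      + {ω | t < X ω}.indicator (fun _ => γ - t) ω) (hint.add hi) (hex γ),
    integral_add hint hi, integral_indicator_const _ hS, hexEq, hexEq, smul_eq_mul] at hkey
  have := mul_le_mul_of_nonneg_right hp (sub_nonneg.2 htγ)
  linarith

end Cvar

/-! ### The standard Gaussian: symmetry and quantiles. -/

section Gaussian

lemma integrable_id_stdGaussianReal : Integrable id (gaussianReal 0 1) :=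
  (memLp_id_gaussianReal 1).integrable (by simp)

lemma stdGaussianReal_map_neg :
    (gaussianReal 0 1).map (fun x => -x) = gaussianReal 0 1 := by
  rw [gaussianReal_map_neg, neg_zero]

/-- Combines the symmetry of the law, `(-x)⁺ = x⁺ - x` and the zero mean. -/
lemma meanExcess_stdGaussianReal_neg (γ : ℝ) :
    meanExcess (gaussianReal 0 1) (-γ) = meanExcess (gaussianReal 0 1) γ + γ := by
  have hν := integrable_id_stdGaussianReal
  have h1 : meanExcess (gaussianReal 0 1) γ = ∫ y, max (-y - γ) 0 ∂(gaussianReal 0 1) := by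
    conv_lhs => rw [meanExcess, ← stdGaussianReal_map_neg]
    rw [integral_map (by fun_prop) (by fun_prop)]
  have h2 : (fun y : ℝ => max (-y - γ) 0) = fun y => max (y - -γ) 0 - (y + γ) := by
    funext y; grind
  have hid : Integrable (fun y : ℝ => y) (gaussianReal 0 1) := hν
  rw [h1, h2, integral_sub (g := fun y => y + γ) (integrable_max_sub hν _)
      (hid.add (integrable_const γ)),
    integral_add hid (integrable_const γ), integral_id_gaussianReal, meanExcess]
  simp

lemma stdGaussianReal_real_Ioi_neg (κ : ℝ) :
    (gaussianReal 0 1).real (Set.Ioi (-κ)) = 1 - (gaussianReal 0 1).real (Set.Ioi κ) := by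
  have : NullSingletonClass (gaussianReal 0 1) := nullSingletonClass_gaussianReal one_ne_zero
  have h1 : (gaussianReal 0 1).real (Set.Ioi (-κ)) = (gaussianReal 0 1).real (Set.Iic κ) := by
    conv_lhs => rw [← stdGaussianReal_map_neg]
    rw [map_measureReal_apply (by fun_prop) measurableSet_Ioi]
    have hpre : (fun x : ℝ => -x) ⁻¹' Set.Ioi (-κ) = Set.Iio κ := by ext; simp
    rw [hpre]
    exact measureReal_congr Iio_ae_eq_Iic
  rw [h1, ← probReal_compl_eq_one_sub measurableSet_Ioi, Set.compl_Ioi]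

/-- Substituting `-γ` for `γ` turns the weight `1 - p` into `p`, so `(1-p) CVaR_p` lies below affine
functions of `p` with slope `γ`. -/
lemma stdGaussianReal_mul_cvar_le {p : ℝ} (hp : p ∈ Set.Ioo (0 : ℝ) 1) (γ : ℝ) :
    (1 - p) * cvar p (gaussianReal 0 1) ≤ p * γ + meanExcess (gaussianReal 0 1) γ := by
  have h := mul_cvar_le integrable_id_stdGaussianReal hp (-γ)
  rw [meanExcess_stdGaussianReal_neg] at h
  linarith

lemma stdGaussianReal_mul_cvar_eq {p κ : ℝ} (hp : p ∈ Set.Ioo (0 : ℝ) 1)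
    (hκ : (gaussianReal 0 1).real (Set.Ioi κ) = p) :
    (1 - p) * cvar p (gaussianReal 0 1) = p * κ + meanExcess (gaussianReal 0 1) κ := by
  have h := mul_cvar_eq_of_quantile integrable_id_stdGaussianReal hp (κ := -κ)
    (by rw [stdGaussianReal_real_Ioi_neg, hκ])
  rw [meanExcess_stdGaussianReal_neg] at h
  linarith

lemma continuous_real_Ioi_stdGaussianReal :
    Continuous fun t => (gaussianReal 0 1).real (Set.Ioi t) := by
  have : NullSingletonClass (gaussianReal 0 1) := nullSingletonClass_gaussianReal one_ne_zero
  have h : (fun t => (gaussianReal 0 1).real (Set.Ioi t)) = fun t : ℝ =>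
      ∫ y, (Set.Ioi t).indicator (fun _ => (1 : ℝ)) y ∂(gaussianReal 0 1) := by
    funext t
    rw [integral_indicator_const _ measurableSet_Ioi, smul_eq_mul, mul_one]
  rw [h, continuous_iff_continuousAt]
  intro t₀
  refine continuousAt_of_dominated (bound := fun _ => 1) (Eventually.of_forall fun t =>
    (measurable_const.indicator measurableSet_Ioi).aestronglyMeasurable)
    (Eventually.of_forall fun t => ae_of_all _ fun y => ?_) (integrable_const _) ?_
  · simp only [Set.indicator_apply]
    split_ifs <;> simp
  · have hne : ∀ᵐ y ∂(gaussianReal 0 1), y ≠ t₀ := by simp [ae_iff]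
    filter_upwards [hne] with y hy
    rcases lt_or_gt_of_ne hy with hlt | hgt
    · refine continuousAt_const.congr (f := fun _ => (0 : ℝ)) ?_
      filter_upwards [Ioi_mem_nhds hlt] with t (ht : y < t)
      simp [ht.le]
    · refine continuousAt_const.congr (f := fun _ => (1 : ℝ)) ?_
      filter_upwards [Iio_mem_nhds hgt] with t (ht : t < y)
      simp [ht]

lemma strictAnti_real_Ioi_stdGaussianReal :
    StrictAnti fun t => (gaussianReal 0 1).real (Set.Ioi t) := by
  intro s t hst
  have hpos : 0 < (gaussianReal 0 1).real (Set.Ioc s t) := by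
    refine ENNReal.toReal_pos (fun h => ?_) (measure_ne_top _ _)
    -- Lebesgue measure is absolutely continuous with respect to the Gaussian, so a null interval
    -- would be degenerate.
    have := gaussianReal_absolutelyContinuous' 0 one_ne_zero h
    simp at this
    linarith
  have h := measureReal_union (μ := gaussianReal 0 1) (s₁ := Set.Ioc s t) (s₂ := Set.Ioi t)
    (Set.disjoint_left.2 fun x hx hx' => not_lt.2 hx.2 hx') measurableSet_Ioi
  rw [Set.Ioc_union_Ioi_eq_Ioi hst.le] at h
  simp only
  linarith

lemma exists_real_Ioi_stdGaussianReal_eq {p : ℝ} (hp : p ∈ Set.Ioo (0 : ℝ) 1) :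
    ∃ κ, (gaussianReal 0 1).real (Set.Ioi κ) = p := by
  have h (t : ℝ) : (gaussianReal 0 1).real (Set.Ioi t) = 1 - cdf (gaussianReal 0 1) t := by
    rw [cdf_eq_real, ← Set.compl_Ioi, probReal_compl_eq_one_sub measurableSet_Ioi]
    ring
  have hbot := tendsto_cdf_atBot (gaussianReal 0 1)
  have htop := tendsto_cdf_atTop (gaussianReal 0 1)
  obtain ⟨s, hs⟩ := (hbot.eventually_lt_const (show 0 < 1 - p by linarith [hp.2])).exists
  obtain ⟨t, ht⟩ := (htop.eventually_const_lt (show 1 - p < 1 by linarith [hp.1])).exists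
  refine mem_range_of_exists_le_of_exists_ge continuous_real_Ioi_stdGaussianReal ⟨t, ?_⟩ ⟨s, ?_⟩
  · rw [h]; linarith
  · rw [h]; linarith

end Gaussian

/-! ### The constant `c_o` as a threshold. -/

section Constant

variable {δ ε : ℝ}

/-- A quantile of level `ε` bounds the difference quotients of `p ↦ (1 - p) CVaR_p`. -/
lemma coExpr_le_quantile (hε : ε ∈ Set.Ioo (0 : ℝ) 1) (hδ : 0 < δ) {κ : ℝ}
    (hκ : (gaussianReal 0 1).real (Set.Ioi κ) = ε) {ε' : ℝ} (hε' : ε' ∈ Set.Ioo ε 1) :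
    coExpr δ ε ε' ≤ κ := by
  have h1 := stdGaussianReal_mul_cvar_eq hε hκ
  have h2 := stdGaussianReal_mul_cvar_le ⟨hε.1.trans hε'.1, hε'.2⟩ κ
  rw [coExpr, div_le_iff₀ (by linarith [hε'.1])]
  linarith

/-- Makes `co` a genuine finite supremum rather than the default value of `sSup` on an unbounded
set. -/
lemma isLUB_co (hε : ε ∈ Set.Ioo (0 : ℝ) 1) (hδ : 0 < δ) :
    IsLUB (coExpr δ ε '' Set.Ioo ε 1) (co δ ε) := by
  obtain ⟨κ, hκ⟩ := exists_real_Ioi_stdGaussianReal_eq hε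
  refine isLUB_csSup ((Set.nonempty_Ioo.2 hε.2).image _) ⟨κ, ?_⟩
  rintro _ ⟨ε', hε', rfl⟩
  exact coExpr_le_quantile hε hδ hκ hε'

/-- Below the quantile, the threshold `c_o ≤ t` says that moving the mass between `t` and the
quantile down to `t` costs at most `δ`. -/
lemma co_le_iff_meanExcess_le (hε : ε ∈ Set.Ioo (0 : ℝ) 1) (hδ : 0 < δ) {κ t : ℝ}
    (hκ : (gaussianReal 0 1).real (Set.Ioi κ) = ε) (ht : t < κ) :
    co δ ε ≤ t ↔ meanExcess (gaussianReal 0 1) t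
      ≤ δ + ε * (κ - t) + meanExcess (gaussianReal 0 1) κ := by
  have hG := stdGaussianReal_mul_cvar_eq hε hκ
  constructor
  · intro h
    -- Test the supremum at `ε' = P(Y > t)`, for which `γ = t` is the minimizer.
    have h1 : ε < (gaussianReal 0 1).real (Set.Ioi t) := by
      rw [← hκ]; exact strictAnti_real_Ioi_stdGaussianReal ht
    have h2 : (gaussianReal 0 1).real (Set.Ioi t) < 1 :=
      (strictAnti_real_Ioi_stdGaussianReal (sub_one_lt t)).trans_le measureReal_le_one
    have h3 := ((isLUB_co hε hδ).1 (Set.mem_image_of_mem _ ⟨h1, h2⟩)).trans h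
    rw [coExpr, div_le_iff₀ (by linarith),
      stdGaussianReal_mul_cvar_eq ⟨hε.1.trans h1, h2⟩ rfl] at h3
    linarith
  · intro h
    refine (isLUB_co hε hδ).2 ?_
    rintro _ ⟨ε', hε', rfl⟩
    have h2 := stdGaussianReal_mul_cvar_le ⟨hε.1.trans hε'.1, hε'.2⟩ t
    rw [coExpr, div_le_iff₀ (by linarith [hε'.1])]
    linarith

lemma co_le_quantile (hε : ε ∈ Set.Ioo (0 : ℝ) 1) (hδ : 0 < δ) {κ : ℝ}
    (hκ : (gaussianReal 0 1).real (Set.Ioi κ) = ε) : co δ ε ≤ κ := by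
  refine (isLUB_co hε hδ).2 ?_
  rintro _ ⟨ε', hε', rfl⟩
  exact coExpr_le_quantile hε hδ hκ hε'

end Constant

/-! ### Standardizing linear functionals of the Gaussian vector. -/

section Matrix

variable {m : ℕ} {S : Matrix (Fin m) (Fin m) ℝ}

lemma inner_sqrtMul_left (u v : EuclideanSpace ℝ (Fin m)) :
    inner ℝ (sqrtMul S u) v = inner ℝ u (sqrtMul S v) := by
  have h : IsSelfAdjoint (Matrix.toEuclideanCLM (𝕜 := ℝ) (CFC.sqrt S)) :=
    (CFC.sqrt_nonneg S).isSelfAdjoint.map _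
  rw [sqrtMul, sqrtMul, ← ContinuousLinearMap.adjoint_inner_left, h.adjoint_eq]

lemma isUnit_sqrt_of_posDef (hS : S.PosDef) : IsUnit (CFC.sqrt S) :=
  (CFC.isUnit_sqrt_iff S hS.posSemidef.nonneg).2 hS.isUnit

lemma sqrtMul_invSqrtMul (hS : S.PosDef) (v : EuclideanSpace ℝ (Fin m)) :
    sqrtMul S (invSqrtMul S v) = v := by
  rw [sqrtMul, invSqrtMul, ← mul_apply_eq_comp, ← map_mul, Matrix.mul_nonsing_inv _
    ((Matrix.isUnit_iff_isUnit_det _).1 (isUnit_sqrt_of_posDef hS)), map_one]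
  rfl

lemma invSqrtMul_sqrtMul (hS : S.PosDef) (v : EuclideanSpace ℝ (Fin m)) :
    invSqrtMul S (sqrtMul S v) = v := by
  rw [sqrtMul, invSqrtMul, ← mul_apply_eq_comp, ← map_mul, Matrix.nonsing_inv_mul _
    ((Matrix.isUnit_iff_isUnit_det _).1 (isUnit_sqrt_of_posDef hS)), map_one]
  rfl

lemma invSqrtMul_smul (c : ℝ) (v : EuclideanSpace ℝ (Fin m)) :
    invSqrtMul S (c • v) = c • invSqrtMul S v := map_smul _ _ _

lemma norm_sqrtMul_pos (hS : S.PosDef) {v : EuclideanSpace ℝ (Fin m)} (hv : v ≠ 0) :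
    0 < ‖sqrtMul S v‖ := by
  refine norm_pos_iff.2 fun h => hv ?_
  rw [← invSqrtMul_sqrtMul hS v, h]
  exact map_zero _

lemma measurable_norm_invSqrtMul_sub :
    Measurable fun z : EuclideanSpace ℝ (Fin m) × EuclideanSpace ℝ (Fin m) =>
      ‖invSqrtMul S (z.1 - z.2)‖ := by
  unfold invSqrtMul
  fun_prop

/-- Cauchy–Schwarz after inserting `Σ^{1/2} Σ^{-1/2}`: the norm dual to `‖Σ^{-1/2} ·‖` is `‖Σ^{1/2}
·‖`. -/
lemma abs_inner_le_norm_invSqrtMul (hS : S.PosDef) (u v : EuclideanSpace ℝ (Fin m)) :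
    |inner ℝ u v| ≤ ‖sqrtMul S u‖ * ‖invSqrtMul S v‖ := by
  conv_lhs => rw [← sqrtMul_invSqrtMul hS v, ← inner_sqrtMul_left]
  exact abs_real_inner_le_norm _ _

/-- The standardization of the linear functional `ξ ↦ uᵀ ξ` under `N(μ, S)`. -/
def standardized (S : Matrix (Fin m) (Fin m) ℝ) (μ u ξ : EuclideanSpace ℝ (Fin m)) : ℝ :=
  inner ℝ u (ξ - μ) / ‖sqrtMul S u‖

lemma measurable_standardized (μ u : EuclideanSpace ℝ (Fin m)) :
    Measurable (standardized S μ u) := by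
  unfold standardized
  fun_prop

/-- Seen through the affine image of a standard Gaussian vector, the functional is the inner product
with a unit vector. -/
lemma map_standardized_multivariateGaussian (hS : S.PosDef) (μ : EuclideanSpace ℝ (Fin m))
    {u : EuclideanSpace ℝ (Fin m)} (hu : u ≠ 0) :
    (multivariateGaussian μ S).map (standardized S μ u) = gaussianReal 0 1 := by
  have hσ := norm_sqrtMul_pos hS hu
  set L : StrongDual ℝ (EuclideanSpace ℝ (Fin m)) :=
    innerSL ℝ (‖sqrtMul S u‖⁻¹ • sqrtMul S u) with hL
  have hcomp : standardized S μ u ∘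
      (fun x => μ + Matrix.toEuclideanCLM (𝕜 := ℝ) (CFC.sqrt S) x) = L := by
    funext x
    have := inner_sqrtMul_left (S := S) u x
    simp only [sqrtMul] at this
    simp [standardized, hL, div_eq_inv_mul, sqrtMul, this]
  have hnorm : ‖L‖ = 1 := by
    rw [hL, innerSL_apply_norm, norm_smul, norm_inv, norm_norm, inv_mul_cancel₀ hσ.ne']
  rw [multivariateGaussian, Measure.map_map (measurable_standardized μ u) (by fun_prop), hcomp,
    IsGaussian.map_eq_gaussianReal, integral_strongDual_stdGaussian, variance_dual_stdGaussian,
    hnorm]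
  simp

lemma inner_le_iff_standardized_le (hS : S.PosDef) {μ u : EuclideanSpace ℝ (Fin m)}
    (hu : u ≠ 0) (ξ : EuclideanSpace ℝ (Fin m)) (r : ℝ) :
    inner ℝ u ξ ≤ r ↔ standardized S μ u ξ ≤ (r - inner ℝ u μ) / ‖sqrtMul S u‖ := by
  rw [standardized, div_le_div_iff_of_pos_right (norm_sqrtMul_pos hS hu), inner_sub_right]
  exact (sub_le_sub_iff_right _).symm

lemma abs_standardized_sub_le (hS : S.PosDef) {u : EuclideanSpace ℝ (Fin m)} (hu : u ≠ 0)
    (μ ξ ζ : EuclideanSpace ℝ (Fin m)) :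
    |standardized S μ u ξ - standardized S μ u ζ| ≤ ‖invSqrtMul S (ξ - ζ)‖ := by
  have hσ := norm_sqrtMul_pos hS hu
  rw [standardized, standardized, ← sub_div, ← inner_sub_right, sub_sub_sub_cancel_right, abs_div,
    abs_of_pos hσ, div_le_iff₀' hσ]
  exact abs_inner_le_norm_invSqrtMul hS u (ξ - ζ)

/-- There is a direction of unit transport cost along which the standardized functional moves at
unit speed. -/
lemma exists_unit_direction (hS : S.PosDef) {u : EuclideanSpace ℝ (Fin m)} (hu : u ≠ 0)
    (μ : EuclideanSpace ℝ (Fin m)) :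
    ∃ w : EuclideanSpace ℝ (Fin m), ‖invSqrtMul S w‖ = 1 ∧
      ∀ ξ (c : ℝ), standardized S μ u (ξ - c • w) = standardized S μ u ξ - c := by
  have hσ := norm_sqrtMul_pos hS hu
  -- `w = Σu / ‖Σ^{1/2} u‖` is the equality case of Cauchy–Schwarz.
  refine ⟨‖sqrtMul S u‖⁻¹ • sqrtMul S (sqrtMul S u), ?_, fun ξ c => ?_⟩
  · rw [invSqrtMul_smul, invSqrtMul_sqrtMul hS, norm_smul, norm_inv, norm_norm,
      inv_mul_cancel₀ hσ.ne']
  · rw [standardized, standardized, sub_right_comm, inner_sub_right, real_inner_smul_right,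
      real_inner_smul_right, ← inner_sqrtMul_left, real_inner_self_eq_norm_sq]
    field_simp

end Matrix

/-! ### Reduction of the chance constraint to the threshold. -/

section Feasibility

variable {m : ℕ} {S : Matrix (Fin m) (Fin m) ℝ} {δ ε t : ℝ}

lemma multivariateGaussian_mem_wassersteinBall (μ : EuclideanSpace ℝ (Fin m)) (δ : ℝ) :
    multivariateGaussian μ S ∈
      wassersteinBall (fun v => ‖invSqrtMul S v‖) (multivariateGaussian μ S) δ := by
  refine ⟨inferInstance, ?_⟩
  refine (iInf₂_le ((multivariateGaussian μ S).map fun ξ => (ξ, ξ)) ?_).trans ?_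
  · constructor
    · rw [Measure.map_map measurable_fst (by fun_prop)]; exact Measure.map_id
    · rw [Measure.map_map measurable_snd (by fun_prop)]; exact Measure.map_id
  · rw [lintegral_map measurable_norm_invSqrtMul_sub.ennreal_ofReal (by fun_prop)]
    simp [invSqrtMul]

/-- If the optimistic chance constraint holds for the standardized functional with threshold `t`,
then `t` is at least `c_o`. -/
lemma co_le_of_le_iSup (hS : S.PosDef) (hε : ε ∈ Set.Ioo (0 : ℝ) 1) (hδ : 0 < δ)
    (μ : EuclideanSpace ℝ (Fin m)) {u : EuclideanSpace ℝ (Fin m)} (hu : u ≠ 0)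
    (h : ENNReal.ofReal (1 - ε) ≤
      ⨆ Q ∈ wassersteinBall (fun v => ‖invSqrtMul S v‖) (multivariateGaussian μ S) δ,
        Q {ξ | standardized S μ u ξ ≤ t}) : co δ ε ≤ t := by
  obtain ⟨κ, hκ⟩ := exists_real_Ioi_stdGaussianReal_eq hε
  rcases le_or_gt κ t with hκt | htκ
  · exact (co_le_quantile hε hδ hκ).trans hκt
  rw [co_le_iff_meanExcess_le hε hδ hκ htκ]
  have hY := measurable_standardized (S := S) μ u
  -- Neither the supremum over `Q` nor the infimum over couplings is known to be attained; a slack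
  -- `η` in both probability and cost is sent to `0` at the end.
  have key : ∀ η ∈ Set.Ioo 0 (1 - ε), meanExcess (gaussianReal 0 1) t ≤
      (δ + η) + (ε + η) * (κ - t) + meanExcess (gaussianReal 0 1) κ := by
    intro η hη
    have h1 : ENNReal.ofReal (1 - ε - η) < ENNReal.ofReal (1 - ε) :=
      (ENNReal.ofReal_lt_ofReal_iff (by linarith [hε.2])).2 (by linarith [hη.1])
    obtain ⟨Q, hQ⟩ := lt_iSup_iff.1 (h1.trans_le h)
    obtain ⟨⟨hQp, hQd⟩, hQ⟩ := lt_iSup_iff.1 hQ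
    have h2 : ENNReal.ofReal δ < ENNReal.ofReal (δ + η) :=
      (ENNReal.ofReal_lt_ofReal_iff (by linarith [hη.1])).2 (by linarith [hη.1])
    obtain ⟨π, hπ⟩ := iInf_lt_iff.1 (hQd.trans_lt h2)
    obtain ⟨⟨hπ1, hπ2⟩, hπ⟩ := iInf_lt_iff.1 hπ
    have hπp : IsProbabilityMeasure π := by
      rw [← hπ1] at hQp
      exact Measure.isProbabilityMeasure_of_map Prod.fst
    refine meanExcess_le_of_coupling integrable_id_stdGaussianReal (π := π)
      (X := fun z => standardized S μ u z.1) (Z := fun z => standardized S μ u z.2)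
      (hY.comp measurable_fst) (hY.comp measurable_snd) ?_ (by linarith [hη.1]) htκ.le ?_ ?_
    · rw [← map_standardized_multivariateGaussian hS μ hu, ← hπ2,
        Measure.map_map hY measurable_snd]
      rfl
    · refine le_trans (lintegral_mono fun z => ?_) hπ.le
      exact ENNReal.ofReal_le_ofReal (abs_standardized_sub_le hS hu μ z.1 z.2)
    · have hA : MeasurableSet {ξ | standardized S μ u ξ ≤ t} :=
        measurableSet_le hY measurable_const
      have h3 : 1 - ε - η ≤ Q.real {ξ | standardized S μ u ξ ≤ t} :=
        (ENNReal.ofReal_le_iff_le_toReal (measure_ne_top _ _)).1 hQ.le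
      have h4 := probReal_compl_eq_one_sub (μ := Q) hA
      rw [← hπ1, map_measureReal_apply measurable_fst hA.compl, hπ1] at h4
      have h5 : {z : EuclideanSpace ℝ (Fin m) × EuclideanSpace ℝ (Fin m) |
          t < standardized S μ u z.1} = Prod.fst ⁻¹' {ξ | standardized S μ u ξ ≤ t}ᶜ := by
        ext z; simp
      rw [h5, h4]
      linarith
  have hlim : Tendsto (fun η : ℝ => (δ + η) + (ε + η) * (κ - t)
      + meanExcess (gaussianReal 0 1) κ) (𝓝[>] 0)
      (𝓝 (δ + ε * (κ - t) + meanExcess (gaussianReal 0 1) κ)) := by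
    refine tendsto_nhdsWithin_of_tendsto_nhds ?_
    have : Continuous fun η : ℝ => (δ + η) + (ε + η) * (κ - t)
      + meanExcess (gaussianReal 0 1) κ := by fun_prop
    simpa using this.tendsto 0
  refine ge_of_tendsto hlim ?_
  filter_upwards [Ioo_mem_nhdsGT (show 0 < 1 - ε by linarith [hε.2])] with η hη using key η hη

/-- Above `c_o`, some distribution in the ball satisfies the chance constraint. -/
lemma exists_mem_wassersteinBall_of_co_le (hS : S.PosDef) (hε : ε ∈ Set.Ioo (0 : ℝ) 1)
    (hδ : 0 < δ) (μ : EuclideanSpace ℝ (Fin m)) {u : EuclideanSpace ℝ (Fin m)} (hu : u ≠ 0)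
    (h : co δ ε ≤ t) :
    ∃ Q ∈ wassersteinBall (fun v => ‖invSqrtMul S v‖) (multivariateGaussian μ S) δ,
      ENNReal.ofReal (1 - ε) ≤ Q {ξ | standardized S μ u ξ ≤ t} := by
  obtain ⟨κ, hκ⟩ := exists_real_Ioi_stdGaussianReal_eq hε
  have hY := measurable_standardized (S := S) μ u
  have hlaw := map_standardized_multivariateGaussian hS μ hu
  -- The event `{≤ κ}` has mass exactly `1 - ε`, so it suffices to transport it into `{≤ t}`.
  have hmass : ENNReal.ofReal (1 - ε) =
      multivariateGaussian μ S {ξ | standardized S μ u ξ ≤ κ} := by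
    have h1 : multivariateGaussian μ S {ξ | standardized S μ u ξ ≤ κ}
        = gaussianReal 0 1 (Set.Iic κ) := by
      rw [← hlaw, Measure.map_apply hY measurableSet_Iic]; rfl
    rw [h1, ← hκ, ← probReal_compl_eq_one_sub measurableSet_Ioi, Set.compl_Ioi,
      ofReal_measureReal]
  rw [hmass]
  rcases le_or_gt κ t with hκt | htκ
  · exact ⟨_, multivariateGaussian_mem_wassersteinBall μ δ,
      measure_mono fun ξ hξ => le_trans hξ hκt⟩
  obtain ⟨w, hw, hmove⟩ := exists_unit_direction hS hu μ
  -- `g` is the distance each value travels: `(t, κ]` collapses to `t`, all else stays.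
  set g : ℝ → ℝ := (Set.Ioc t κ).indicator fun y => y - t with hg
  have hgm : Measurable g := (by fun_prop : Measurable fun y : ℝ => y - t).indicator
    measurableSet_Ioc
  have hg0 (y : ℝ) : 0 ≤ g y := Set.indicator_nonneg (fun y hy => sub_nonneg.2 hy.1.le) y
  set T : EuclideanSpace ℝ (Fin m) → EuclideanSpace ℝ (Fin m) :=
    fun ξ => ξ - g (standardized S μ u ξ) • w with hT
  have hTm : Measurable T := measurable_id.sub ((hgm.comp hY).smul_const w)
  refine ⟨(multivariateGaussian μ S).map T,
    ⟨Measure.isProbabilityMeasure_map hTm.aemeasurable, ?_⟩, ?_⟩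
  · refine (iInf₂_le ((multivariateGaussian μ S).map fun ξ => (T ξ, ξ)) ?_).trans ?_
    · constructor
      · rw [Measure.map_map measurable_fst (by fun_prop)]; rfl
      · rw [Measure.map_map measurable_snd (by fun_prop)]; exact Measure.map_id
    · rw [lintegral_map measurable_norm_invSqrtMul_sub.ennreal_ofReal (by fun_prop)]
      have hcost (ξ : EuclideanSpace ℝ (Fin m)) :
          ‖invSqrtMul S (T ξ - ξ)‖ = g (standardized S μ u ξ) := by
        rw [hT, sub_sub_cancel_left, ← neg_smul, invSqrtMul_smul, norm_smul, hw, norm_neg,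
          Real.norm_of_nonneg (hg0 _), mul_one]
      simp only [hcost]
      have hgi : Integrable g (gaussianReal 0 1) :=
        (integrable_id_stdGaussianReal.sub (integrable_const t)).indicator measurableSet_Ioc
      rw [← lintegral_map (f := fun y => ENNReal.ofReal (g y)) hgm.ennreal_ofReal hY, hlaw,
        ← ofReal_integral_eq_lintegral_ofReal hgi (ae_of_all _ hg0)]
      refine ENNReal.ofReal_le_ofReal ?_
      rw [integral_indicator_Ioc_sub integrable_id_stdGaussianReal htκ.le, hκ]
      have := (co_le_iff_meanExcess_le hε hδ hκ htκ).1 h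
      linarith
  · rw [Measure.map_apply hTm (measurableSet_le hY measurable_const)]
    refine measure_mono fun ξ (hξ : standardized S μ u ξ ≤ κ) => ?_
    simp only [Set.mem_preimage, Set.mem_ofPred_eq, hT, hmove, hg, Set.indicator_apply, Set.mem_Ioc]
    split_ifs with hc <;> grind

lemma le_iSup_wassersteinBall_iff (hS : S.PosDef) (hε : ε ∈ Set.Ioo (0 : ℝ) 1) (hδ : 0 < δ)
    (μ u : EuclideanSpace ℝ (Fin m)) (r : ℝ) :
    (ENNReal.ofReal (1 - ε) ≤
      ⨆ Q ∈ wassersteinBall (fun v => ‖invSqrtMul S v‖) (multivariateGaussian μ S) δ,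
        Q {ξ | inner ℝ u ξ ≤ r}) ↔ inner ℝ u μ + co δ ε * ‖sqrtMul S u‖ ≤ r := by
  -- With `u = 0` there is nothing to standardize: the event is everything or empty, and both sides
  -- say `0 ≤ r` because `1 - ε > 0`.
  by_cases hu : u = 0
  · subst hu
    have h0 : sqrtMul S 0 = 0 := map_zero _
    simp only [inner_zero_left, h0, norm_zero, mul_zero, add_zero]
    have hε' : 0 < ENNReal.ofReal (1 - ε) := ENNReal.ofReal_pos.2 (by linarith [hε.2])
    refine ⟨fun h => ?_, fun h => ?_⟩
    · by_contra hr
      simp [hr] at h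
      linarith [hε.2]
    · refine le_trans ?_ (le_iSup₂ _ (multivariateGaussian_mem_wassersteinBall μ δ))
      simp [h, hε.1.le]
  · have hσ := norm_sqrtMul_pos hS hu
    simp only [inner_le_iff_standardized_le hS (μ := μ) hu _ r]
    trans co δ ε ≤ (r - inner ℝ u μ) / ‖sqrtMul S u‖
    · refine ⟨co_le_of_le_iSup hS hε hδ μ hu, fun h => ?_⟩
      obtain ⟨Q, hQ, hle⟩ := exists_mem_wassersteinBall_of_co_le hS hε hδ μ hu h
      exact hle.trans (le_iSup₂ (f := fun (Q : Measure (EuclideanSpace ℝ (Fin m))) _ =>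
        Q {ξ | standardized S μ u ξ ≤ (r - inner ℝ u μ) / ‖sqrtMul S u‖}) Q hQ)
    · rw [le_div_iff₀ hσ, le_sub_iff_add_le']

end Feasibility

/-! ### Second-order cone sets. -/

lemma IsSecondOrderConeSet.convex {n : ℕ} {X : Set (EuclideanSpace ℝ (Fin n))}
    (h : IsSecondOrderConeSet X) : Convex ℝ X := by
  obtain ⟨k, F, g, rfl⟩ := h
  intro x hx y hy s r hs hr hsr
  simp only [Set.mem_ofPred_eq] at hx hy ⊢
  rw [Convex.combo_affine_apply hsr, Convex.combo_affine_apply hsr]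
  calc ‖s • F x + r • F y‖ ≤ s * ‖F x‖ + r * ‖F y‖ := by
        refine (norm_add_le _ _).trans_eq ?_
        rw [norm_smul, norm_smul, Real.norm_of_nonneg hs, Real.norm_of_nonneg hr]
    _ ≤ s • g x + r • g y := by simp only [smul_eq_mul]; gcongr

/-- Take `F = c Σ^{1/2} a` and `g = b - μᵀa`; the sign of `c` lets it move inside the norm. -/
lemma isSecondOrderConeSet_of_nonneg {n m : ℕ} (μ : EuclideanSpace ℝ (Fin m))
    (S : Matrix (Fin m) (Fin m) ℝ) {c : ℝ} (hc : 0 ≤ c)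
    (a : EuclideanSpace ℝ (Fin n) →ᵃ[ℝ] EuclideanSpace ℝ (Fin m))
    (b : EuclideanSpace ℝ (Fin n) →ᵃ[ℝ] ℝ) :
    IsSecondOrderConeSet {x | inner ℝ (a x) μ + c * ‖sqrtMul S (a x)‖ ≤ b x} := by
  refine ⟨m, (c • (Matrix.toEuclideanCLM (𝕜 := ℝ) (CFC.sqrt S)).toLinearMap).toAffineMap.comp a,
    b - ((innerSL ℝ μ).toLinearMap).toAffineMap.comp a, ?_⟩
  ext x
  simp only [Set.mem_ofPred_eq, AffineMap.comp_apply, LinearMap.coe_toAffineMap,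
    LinearMap.smul_apply, norm_smul, Real.norm_of_nonneg hc, AffineMap.coe_sub, Pi.sub_apply]
  change _ ↔ c * ‖sqrtMul S (a x)‖ ≤ b x - inner ℝ μ (a x)
  rw [real_inner_comm, le_sub_iff_add_le']

end OptimisticCC

end

theorem mainTheorem4 (n m : ℕ) (μ : EuclideanSpace ℝ (Fin m)) (S : Matrix (Fin m) (Fin m) ℝ)
    (hS : S.PosDef) (ε δ : ℝ) (hε : ε ∈ Set.Ioo (0 : ℝ) 1) (hδ : 0 < δ)
    (a : EuclideanSpace ℝ (Fin n) →ᵃ[ℝ] EuclideanSpace ℝ (Fin m))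
    (b : EuclideanSpace ℝ (Fin n) →ᵃ[ℝ] ℝ)
    (X : Set (EuclideanSpace ℝ (Fin n)))
    (hX : X = OptimisticCC.feasibleRegion
      (OptimisticCC.wassersteinBall (fun v => ‖OptimisticCC.invSqrtMul S v‖)
        (multivariateGaussian μ S) δ) ε a b) :
    IsLUB (OptimisticCC.coExpr δ ε '' Set.Ioo ε 1) (OptimisticCC.co δ ε) ∧
    X = {x | inner ℝ (a x) μ + OptimisticCC.co δ ε * ‖OptimisticCC.sqrtMul S (a x)‖ ≤ b x} ∧
    (0 ≤ OptimisticCC.co δ ε → Convex ℝ X ∧ OptimisticCC.IsSecondOrderConeSet X) := by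
  have hXeq : X = {x | inner ℝ (a x) μ +
      OptimisticCC.co δ ε * ‖OptimisticCC.sqrtMul S (a x)‖ ≤ b x} := by
    rw [hX]
    ext x
    exact OptimisticCC.le_iSup_wassersteinBall_iff hS hε hδ μ (a x) (b x)
  refine ⟨OptimisticCC.isLUB_co hε hδ, hXeq, fun hc => ?_⟩
  have hcone : OptimisticCC.IsSecondOrderConeSet X :=
    hXeq ▸ OptimisticCC.isSecondOrderConeSet_of_nonneg μ S hc a b
  exact ⟨hcone.convex, hcone⟩
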